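/- Fix integers $n\ge 1$, $j\ge 1$. Write $e_{kl}$ for the elementary $(2n+1)\times(2n+1)$ matrices and put $\rho_n=\sum_{i=1}^{2n+1}(-1)^{n+i-1}e_{i,2n+2-i}$, $b=\sum_{i=1}^{2n}e_{i+1,i}$, $\beta=\tfrac12(e_{1,2n}+e_{2,2n+1})$, $J_B(\lambda)=\beta\lambda+b$, $\beta_i=e_{n+1-i,n+i}+e_{n+2-i,n+1+i}$ for $1\le i\le n$, $V_n=\bigoplus_{i=1}^n\mathbb R\beta_i$, and $\pi_0(y)=\sum_{i=1}^n y_{n+i,n+1-i}\,\beta_i^t$. Let $o(n+1,n)$ be the Lie algebra of real trace-free matrices $A$ with $A^t\rho_n+\rho_nA=0$, and let $O_{\mathbb C}(n+1,n)=\{g\in SL(2n+1,\mathbb C): g^t\rho_n g=\rho_n\}$. Let $u:\mathbb R^2\to V_n$ be a smooth function of $(x,t)$. Let $T(u,\lambda)=\beta\lambda+\sum_{i\le 0}T_i\lambda^i$ be the unique formal series with smooth $o(n+1,n)$-valued coefficients satisfying $$[\partial_x+J_B(\lambda)+u,\,T(u,\lambda)]=0,\qquad T(u,\lambda)^{2n+1}=\lambda\,T(u,\lambda).$$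 Write $T_{2j-1,0}(u)$ for the coefficient of $\lambda^0$ in $T(u,\lambda)^{2j-1}$ and $(\ )_+$ for the part of a series with non-negative powers of $\lambda$. For a smooth $V_n^t$-valued $v$, let $P_u(v)$ be the unique smooth $o(n+1,n)$-valued function with $[\partial_x+b+u,P_u(v)]\in V_n$ and $\pi_0(P_u(v))=v$. Put $\eta_j(u)=T_{2j-1,0}(u)-P_u(\pi_0(T_{2j-1,0}(u)))$. The $(2j-1)$-th $\hat B_n^{(1)}$-KdV flow is $$u_t=[\partial_x+b+u,\,P_u(\pi_0(T_{2j-1,0}(u)))].$$ A frame of a solution $u$ is a map $E(x,t,\lambda)\in O_{\mathbb C}(n+1,n)$, smooth in $(x,t)\in\mathbb R^2$ and holomorphic in $\lambda\in\mathbb C$, with $$E^{-1}E_x=J_B(\lambda)+u,\qquad E^{-1}E_t=(T(u,\lambda)^{2j-1})_+-\eta_j(u),\qquad \overline{E(x,t,\bar\lambda)}=E(x,t,\lambda).$$ Let $u=\sum_{i=1}^n u_i\beta_i$ be a smooth solution on $\mathbb R^2$ of the $(2j-1)$-th $\hat B_n^{(1)}$-KdV flow, let $r\in\mathbb R\setminus\{0\}$,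 and put $\Gamma(r)=\mathrm{diag}(1,r,\dots,r^{2n})$ and $(r\cdot u_i)(x,t)=r^{2i}u_i(rx,r^{2j-1}t)$ for $1\le i\le n$. Then: 1. $r\odot u=\sum_{i=1}^n(r\cdot u_i)\beta_i$ is a solution of the $(2j-1)$-th $\hat B_n^{(1)}$-KdV flow. 2. If $E(x,t,\lambda)$ is a frame of $u$, then $(r\odot E)(x,t,\lambda)=\Gamma(r)^{-1}E(rx,r^{2j-1}t,r^{-2n}\lambda)\Gamma(r)$ is a frame of $r\odot u$. 3. $(r,u)\mapsto r\odot u$, for $r>0$, defines an action of the multiplicative group $\mathbb R^+$ on the space of smooth solutions $u:\mathbb R^2\to V_n$ of the $(2j-1)$-th $\hat B_n^{(1)}$-KdV flow. -/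

import Mathlib

open scoped ContDiff Matrix

noncomputable section

namespace BnKdV

/-- Square matrices of size `2n+1`. The row with the 1-based number `i` has index `i - 1`. -/
abbrev Mat (n : ℕ) (K : Type) : Type := Matrix (Fin (2 * n + 1)) (Fin (2 * n + 1)) K

/-- The matrix `ρ_n = ∑_{i=1}^{2n+1} (-1)^{n+i-1} e_{i,2n+2-i}` of the bilinear form of index `n`. -/
def rho (n : ℕ) (K : Type) [CommRing K] : Mat n K :=
  Matrix.of fun a c => if (a : ℕ) + (c : ℕ) = 2 * n then (-1) ^ (n + (a : ℕ)) else 0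

/-- The group `O_ℂ(n+1,n)`: determinant one and `gᵗ ρ_n g = ρ_n`. -/
def IsOC (n : ℕ) (g : Mat n ℂ) : Prop :=
  g.det = 1 ∧ gᵀ * rho n ℂ * g = rho n ℂ

/-- The real Lie algebra `o(n+1,n)`: trace zero and `Aᵗ ρ_n + ρ_n A = 0`. -/
def IsO (n : ℕ) (A : Mat n ℝ) : Prop :=
  A.trace = 0 ∧ Aᵀ * rho n ℝ + rho n ℝ * A = 0

/-- `β = (e_{1,2n} + e_{2,2n+1}) / 2`. -/
def beta (n : ℕ) : Mat n ℝ :=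
  Matrix.of fun a c =>
    if ((a : ℕ) = 0 ∧ (c : ℕ) + 1 = 2 * n) ∨ ((a : ℕ) = 1 ∧ (c : ℕ) = 2 * n) then 1 / 2 else 0

/-- `b = ∑_{i=1}^{2n} e_{i+1,i}`. -/
def bMat (n : ℕ) : Mat n ℝ :=
  Matrix.of fun a c => if (a : ℕ) = (c : ℕ) + 1 then 1 else 0

/-- With `i = k + 1`, the matrix `β_i = e_{n+1-i,n+i} + e_{n+2-i,n+1+i}`, for `1 ≤ i ≤ n`. -/
def betaV (n : ℕ) (k : Fin n) : Mat n ℝ :=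
  Matrix.of fun a c =>
    if ((a : ℕ) + k + 1 = n ∧ (c : ℕ) = n + k) ∨ ((a : ℕ) + k = n ∧ (c : ℕ) = n + k + 1)
    then 1 else 0

/-- `V_n`, the real span of `β_1, …, β_n`. -/
def VSub (n : ℕ) : Submodule ℝ (Mat n ℝ) :=
  Submodule.span ℝ (Set.range (betaV n))

/-- The projection `π₀(y) = ∑_{i=1}^n y_{n+i,n+1-i} β_iᵗ` onto `V_nᵗ`. -/
def pi0 (n : ℕ) (y : Mat n ℝ) : Mat n ℝ :=
  ∑ k : Fin n, y ⟨n + k, by omega⟩ ⟨n - 1 - k, by omega⟩ • (betaV n k)ᵀ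

/-- Formal series `∑_{i ≤ N} ξ_i λ^i`, as Laurent series in the variable `λ⁻¹`:
the coefficient `ξ_i` of `λ^i` is `ξ.coeff (-i)`. -/
abbrev Loop (n : ℕ) : Type := LaurentSeries (Mat n ℝ)

/-- The coefficient of `λ^i`. -/
def lamCoeff {n : ℕ} (ξ : Loop n) (i : ℤ) : Mat n ℝ := ξ.coeff (-i)

/-- The monomial `A λ^i`. -/
def mono {n : ℕ} (i : ℤ) (A : Mat n ℝ) : Loop n := HahnSeries.single (-i) A

/-- `J_B(λ) = β λ + b`. -/
def JB (n : ℕ) : Loop n := mono 1 (beta n) + mono 0 (bMat n)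

/-- The value at `z ∈ ℂ` of `ξ₊(λ) = ∑_{i ≥ 0} ξ_i λ^i`, which is a finite sum. -/
def plusEval {n : ℕ} (ξ : Loop n) (z : ℂ) : Mat n ℂ :=
  ∑ᶠ i : ℕ, z ^ i • (lamCoeff ξ i).map Complex.ofReal

/-- The partial derivative in `x`, entry by entry, of a matrix-valued function of `(x,t)`. -/
def dx {n : ℕ} {K : Type} [NormedAddCommGroup K] [NormedSpace ℝ K]
    (A : ℝ × ℝ → Mat n K) (p : ℝ × ℝ) : Mat n K :=
  Matrix.of fun a c => deriv (fun s : ℝ => A (s, p.2) a c) p.1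

/-- The partial derivative in `t`, entry by entry, of a matrix-valued function of `(x,t)`. -/
def dt {n : ℕ} {K : Type} [NormedAddCommGroup K] [NormedSpace ℝ K]
    (A : ℝ × ℝ → Mat n K) (p : ℝ × ℝ) : Mat n K :=
  Matrix.of fun a c => deriv (fun s : ℝ => A (p.1, s) a c) p.2

/-- Smoothness of a matrix-valued function of `(x,t)`. -/
def SmoothMat {n : ℕ} {K : Type} [NormedAddCommGroup K] [NormedSpace ℝ K]
    (A : ℝ × ℝ → Mat n K) : Prop :=
  ∀ a c, ContDiff ℝ ∞ (fun p => A p a c)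

/-- `T = T(u,λ)`: the (unique) series `βλ + ∑_{i ≤ 0} T_i λ^i` with smooth coefficients in
`o(n+1,n)` such that `[∂_x + J_B(λ) + u, T] = 0` and `T^{2n+1} = λ T`. -/
structure IsT (n : ℕ) (u : ℝ × ℝ → Mat n ℝ) (T : ℝ × ℝ → Loop n) : Prop where
  smooth : ∀ i : ℤ, SmoothMat (fun p => lamCoeff (T p) i)
  mem_o : ∀ p, ∀ i : ℤ, IsO n (lamCoeff (T p) i)
  coeff_one : ∀ p, lamCoeff (T p) 1 = beta n
  coeff_gt : ∀ p, ∀ i : ℤ, 1 < i → lamCoeff (T p) i = 0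
  commute : ∀ p, ∀ i : ℤ,
    dx (fun p' => lamCoeff (T p') i) p
      + lamCoeff ((JB n + mono 0 (u p)) * T p - T p * (JB n + mono 0 (u p))) i = 0
  pow : ∀ p, T p ^ (2 * n + 1) = mono 1 1 * T p

/-- `[∂_x + b + u, Y] = Y_x + [b + u, Y]`. -/
def adL {n : ℕ} (u Y : ℝ × ℝ → Mat n ℝ) (p : ℝ × ℝ) : Mat n ℝ :=
  dx Y p + ((bMat n + u p) * Y p - Y p * (bMat n + u p))

/-- `Y = P_u(v)`: the (unique) smooth `o(n+1,n)`-valued `Y` such that `[∂_x + b + u, Y]` is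
`V_n`-valued and `π₀(Y) = v`. -/
structure IsP (n : ℕ) (u v Y : ℝ × ℝ → Mat n ℝ) : Prop where
  smooth : SmoothMat Y
  mem_o : ∀ p, IsO n (Y p)
  mem_V : ∀ p, adL u Y p ∈ VSub n
  proj : ∀ p, pi0 n (Y p) = v p

/-- `u : ℝ² → V_n` is a smooth solution of the `(2j-1)`-th KdV flow
`u_t = [∂_x + b + u, P_u(π₀(T_{2j-1,0}(u)))]`, where `T_{2j-1,0}(u)` is the coefficient of `λ^0`
in `T(u,λ)^{2j-1}`. -/
def IsKdVSolution (n j : ℕ) (u : ℝ × ℝ → Mat n ℝ) : Prop :=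
  SmoothMat u ∧ (∀ p, u p ∈ VSub n) ∧
    ∃ (T : ℝ × ℝ → Loop n) (Y : ℝ × ℝ → Mat n ℝ),
      IsT n u T ∧ IsP n u (fun p => pi0 n (lamCoeff (T p ^ (2 * j - 1)) 0)) Y ∧
      ∀ p, dt u p = adL u Y p

/-- `E(x,t,λ) ∈ O_ℂ(n+1,n)` is a frame of the solution `u` of the `(2j-1)`-th KdV flow:
it is smooth in `(x,t)`, holomorphic in `λ ∈ ℂ`, and
`E⁻¹ E_x = J_B(λ) + u`, `E⁻¹ E_t = (T(u,λ)^{2j-1})₊ - η_j(u)`, and the complex conjugate of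
`E(x,t,λ̄)` is `E(x,t,λ)`. Here `η_j(u) = T_{2j-1,0}(u) - P_u(π₀(T_{2j-1,0}(u)))`. -/
def IsKdVFrame (n j : ℕ) (u : ℝ × ℝ → Mat n ℝ) (E : ℝ × ℝ → ℂ → Mat n ℂ) : Prop :=
  (∀ p z, IsOC n (E p z)) ∧
  (∀ z, SmoothMat (fun p => E p z)) ∧
  (∀ p a c, Differentiable ℂ (fun z => E p z a c)) ∧
  (∀ p z, (E p (starRingEnd ℂ z)).map (starRingEnd ℂ) = E p z) ∧
  (∀ p z, (E p z)⁻¹ * dx (fun p' => E p' z) p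
      = z • (beta n).map Complex.ofReal + (bMat n + u p).map Complex.ofReal) ∧
  ∃ (T : ℝ × ℝ → Loop n) (Y : ℝ × ℝ → Mat n ℝ),
    IsT n u T ∧ IsP n u (fun p => pi0 n (lamCoeff (T p ^ (2 * j - 1)) 0)) Y ∧
    ∀ p z, (E p z)⁻¹ * dt (fun p' => E p' z) p
      = plusEval (T p ^ (2 * j - 1)) z
        - (lamCoeff (T p ^ (2 * j - 1)) 0 - Y p).map Complex.ofReal

/-- `u = ∑_{i=1}^n u_i β_i`. The component `u_i` is `u k` with `i = k + 1`. -/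
def combV {n : ℕ} (u : Fin n → ℝ × ℝ → ℝ) (p : ℝ × ℝ) : Mat n ℝ :=
  ∑ k, u k p • betaV n k

/-- The components of `r ⊙ u`: `(r · u_i)(x,t) = r^{2i} u_i(rx, r^{2j-1}t)`, with `i = k + 1`. -/
def scaleU {n : ℕ} (j : ℕ) (r : ℝ) (u : Fin n → ℝ × ℝ → ℝ) : Fin n → ℝ × ℝ → ℝ :=
  fun k p => r ^ (2 * ((k : ℕ) + 1)) * u k (r * p.1, r ^ (2 * j - 1) * p.2)

/-- `Γ(r) = diag(1, r, …, r^{2n})`. -/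
def Gam (n : ℕ) (r : ℝ) : Mat n ℂ := Matrix.diagonal fun a => (r : ℂ) ^ (a : ℕ)

/-- `(r ⊙ E)(x,t,λ) = Γ(r)⁻¹ E(rx, r^{2j-1}t, r^{-2n}λ) Γ(r)`. -/
def scaleE {n : ℕ} (j : ℕ) (r : ℝ) (E : ℝ × ℝ → ℂ → Mat n ℂ) : ℝ × ℝ → ℂ → Mat n ℂ :=
  fun p z => (Gam n r)⁻¹ *
    E (r * p.1, r ^ (2 * j - 1) * p.2) (((r : ℂ) ^ (2 * n))⁻¹ * z) * Gam n r

/-- The space of solutions `u = ∑ u_i β_i` of the `(2j-1)`-th KdV flow. -/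
def SolSpace (n j : ℕ) : Type :=
  {u : Fin n → ℝ × ℝ → ℝ // IsKdVSolution n j (combV u)}

end BnKdV

end

/-! The flow is homogeneous for the grading by diagonals. Conjugation by `Γ(r)` multiplies the entry
`(a,c)` by `r^(c-a)`; `b`, `β` and `β_i` each lie on one diagonal, of degree `-1`, `2n-1` and
`2i-1`. Hence the substitution `ξ(λ) ↦ r Γ(r)⁻¹ ξ(r^{-2n}λ) Γ(r)` fixes `J_B` (`loopConj_JB`) and
multiplies `β_i` by `r^{2i}`, so `r ⊙ u` is this substitution applied to `u(rx, r^{2j-1}t)`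
(`combV_scaleU`).

The substitution respects products up to the scalar factor, and the chain rule gives `∂_x` the same
factor `r`. It therefore carries the equations for `T` to those for `r ⊙ u` (`IsT.rescale`),
multiplies `T^{2j-1}` by `r^{2j-1}`, and does likewise with `P_u` (`IsP.rescale_flow`). The
transformed series and potential serve as witnesses, so their uniqueness plays no role. The factor
`r^{2j-1}` is matched by the rescaling of `t`; frames follow by conjugating both equations. -/

noncomputable section

namespace BnKdV

/-! ### Conjugation by `Γ(r)` and the form `ρ_n`. -/

section Conjugation

variable {n : ℕ} {K : Type} [Field K]

/-- The map `A ↦ Γ(r)⁻¹ A Γ(r)`, written entry by entry, as an endomorphism of the algebra of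
matrices. -/
def gradeConj (n : ℕ) {K : Type} [Field K] (r : K) (hr : r ≠ 0) : Mat n K →ₐ[K] Mat n K where
  toFun A := Matrix.of fun a c => (r ^ (a : ℕ))⁻¹ * A a c * r ^ (c : ℕ)
  map_one' := by
    ext a c
    by_cases h : a = c
    · subst h; simp [hr]
    · simp [h]
  map_mul' A B := by
    ext a c
    simp only [Matrix.of_apply, Matrix.mul_apply, Finset.mul_sum, Finset.sum_mul]
    refine Finset.sum_congr rfl fun k _ => ?_
    have : r ^ (k : ℕ) ≠ 0 := pow_ne_zero _ hr
    field_simp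
  map_zero' := by ext a c; simp
  map_add' A B := by
    ext a c
    simp only [Matrix.of_apply, Matrix.add_apply]
    ring
  commutes' x := by
    ext a c
    by_cases h : a = c
    · subst h
      have : r ^ (a : ℕ) ≠ 0 := pow_ne_zero _ hr
      simp only [Matrix.of_apply, Matrix.algebraMap_matrix_apply, if_true]
      field_simp
    · simp [h, Matrix.algebraMap_matrix_apply]

variable {r : K} (hr : r ≠ 0)

theorem gradeConj_apply (A : Mat n K) (a c : Fin (2 * n + 1)) :
    gradeConj n r hr A a c = (r ^ (a : ℕ))⁻¹ * A a c * r ^ (c : ℕ) := rfl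

theorem gradeConj_injective : Function.Injective (gradeConj n r hr) := by
  intro A B h
  ext a c
  have h1 := congrFun (congrFun h a) c
  simpa [gradeConj_apply, hr] using h1

theorem trace_gradeConj (A : Mat n K) : (gradeConj n r hr A).trace = A.trace := by
  refine Finset.sum_congr rfl fun a _ => ?_
  have : r ^ (a : ℕ) ≠ 0 := pow_ne_zero _ hr
  simp only [Matrix.diag_apply, gradeConj_apply]
  field_simp

/-- Since `ρ_n` lives on the antidiagonal `k + c = 2n`, the weight `r^{-k}` equals `r^{-2n} r^c`.
Both terms of the Lie algebra condition thus acquire the same two-sided diagonal factor. -/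
theorem transpose_gradeConj_mul_rho (A : Mat n K) :
    (gradeConj n r hr A)ᵀ * rho n K = (r ^ (2 * n))⁻¹ •
      (Matrix.diagonal (fun a : Fin (2 * n + 1) => r ^ (a : ℕ)) * (Aᵀ * rho n K) *
        Matrix.diagonal (fun a : Fin (2 * n + 1) => r ^ (a : ℕ))) := by
  ext a c
  rw [Matrix.smul_apply, Matrix.mul_diagonal, Matrix.diagonal_mul, smul_eq_mul, Matrix.mul_apply,
    Matrix.mul_apply, Finset.mul_sum, Finset.sum_mul, Finset.mul_sum]
  refine Finset.sum_congr rfl fun k _ => ?_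
  rw [Matrix.transpose_apply, Matrix.transpose_apply, gradeConj_apply]
  by_cases h : (k : ℕ) + (c : ℕ) = 2 * n
  · have h1 : r ^ (k : ℕ) ≠ 0 := pow_ne_zero _ hr
    have h2 : r ^ (c : ℕ) ≠ 0 := pow_ne_zero _ hr
    have h3 : r ^ (2 * n) = r ^ (k : ℕ) * r ^ (c : ℕ) := by rw [← pow_add, h]
    rw [h3]
    field_simp
  · simp [rho, h]

theorem rho_mul_gradeConj (A : Mat n K) :
    rho n K * gradeConj n r hr A = (r ^ (2 * n))⁻¹ •
      (Matrix.diagonal (fun a : Fin (2 * n + 1) => r ^ (a : ℕ)) * (rho n K * A) *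
        Matrix.diagonal (fun a : Fin (2 * n + 1) => r ^ (a : ℕ))) := by
  ext a c
  rw [Matrix.smul_apply, Matrix.mul_diagonal, Matrix.diagonal_mul, smul_eq_mul, Matrix.mul_apply,
    Matrix.mul_apply, Finset.mul_sum, Finset.sum_mul, Finset.mul_sum]
  refine Finset.sum_congr rfl fun k _ => ?_
  rw [gradeConj_apply]
  by_cases h : (a : ℕ) + (k : ℕ) = 2 * n
  · have h1 : r ^ (k : ℕ) ≠ 0 := pow_ne_zero _ hr
    have h2 : r ^ (a : ℕ) ≠ 0 := pow_ne_zero _ hr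
    have h3 : r ^ (2 * n) = r ^ (a : ℕ) * r ^ (k : ℕ) := by rw [← pow_add, h]
    rw [h3]
    field_simp
  · simp [rho, h]

theorem smul_diagonal_mul_rho_mul_diagonal {r : K} (hr : r ≠ 0) : (r ^ (2 * n))⁻¹ •
      (Matrix.diagonal (fun a : Fin (2 * n + 1) => r ^ (a : ℕ)) * rho n K *
        Matrix.diagonal (fun a : Fin (2 * n + 1) => r ^ (a : ℕ))) = rho n K := by
  have h := rho_mul_gradeConj hr (1 : Mat n K)
  rw [map_one, mul_one] at h
  exact h.symm

end Conjugation

variable {n : ℕ}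

theorem gam_inv_mul_mul_gam {r : ℝ} (hr : (r : ℂ) ≠ 0) (A : Mat n ℂ) :
    (Gam n r)⁻¹ * A * Gam n r = gradeConj n (r : ℂ) hr A := by
  have h : (Gam n r)⁻¹ = Matrix.diagonal fun a : Fin (2 * n + 1) => ((r : ℂ) ^ (a : ℕ))⁻¹ := by
    refine Matrix.inv_eq_left_inv ?_
    simp [Gam, Matrix.diagonal_mul_diagonal, hr]
  ext a c
  rw [h, Gam, Matrix.mul_diagonal, Matrix.diagonal_mul, gradeConj_apply]

theorem map_gradeConj {r : ℝ} (hr : r ≠ 0) (hr' : (r : ℂ) ≠ 0) (A : Mat n ℝ) :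
    (gradeConj n r hr A).map Complex.ofReal = gradeConj n (r : ℂ) hr' (A.map Complex.ofReal) := by
  ext a c
  simp [gradeConj_apply]

theorem IsOC.gradeConj {r : ℂ} (hr : r ≠ 0) {g : Mat n ℂ} (hg : IsOC n g) :
    IsOC n (gradeConj n r hr g) := by
  refine ⟨?_, ?_⟩
  · have h : BnKdV.gradeConj n r hr g =
        Matrix.diagonal (fun a : Fin (2 * n + 1) => (r ^ (a : ℕ))⁻¹) * g *
          Matrix.diagonal (fun a : Fin (2 * n + 1) => r ^ (a : ℕ)) := by
      ext a c
      rw [Matrix.mul_diagonal, Matrix.diagonal_mul, gradeConj_apply]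
    rw [h, Matrix.det_mul, Matrix.det_mul, hg.1, Matrix.det_diagonal, Matrix.det_diagonal,
      mul_one, ← Finset.prod_mul_distrib]
    exact Finset.prod_eq_one fun a _ => inv_mul_cancel₀ (pow_ne_zero _ hr)
  · rw [transpose_gradeConj_mul_rho]
    have h : Matrix.diagonal (fun a : Fin (2 * n + 1) => r ^ (a : ℕ)) *
        BnKdV.gradeConj n r hr g = g * Matrix.diagonal (fun a : Fin (2 * n + 1) => r ^ (a : ℕ)) := by
      ext a c
      rw [Matrix.mul_diagonal, Matrix.diagonal_mul, gradeConj_apply, ← mul_assoc, ← mul_assoc,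
        mul_inv_cancel₀ (pow_ne_zero _ hr), one_mul]
    rw [Matrix.smul_mul, Matrix.mul_assoc, h, ← Matrix.mul_assoc,
      Matrix.mul_assoc (Matrix.diagonal _), hg.2, smul_diagonal_mul_rho_mul_diagonal hr]

theorem IsO.gradeConj {r : ℝ} (hr : r ≠ 0) {A : Mat n ℝ} (hA : IsO n A) :
    IsO n (gradeConj n r hr A) := by
  refine ⟨by rw [trace_gradeConj, hA.1], ?_⟩
  rw [transpose_gradeConj_mul_rho, rho_mul_gradeConj, ← smul_add, ← add_mul, ← mul_add, hA.2]
  simp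

theorem IsO.smul {A : Mat n ℝ} (hA : IsO n A) (c : ℝ) : IsO n (c • A) := by
  refine ⟨by rw [Matrix.trace_smul, hA.1, smul_zero], ?_⟩
  rw [Matrix.transpose_smul, Matrix.smul_mul, Matrix.mul_smul, ← smul_add, hA.2, smul_zero]

/-! ### Degrees of `b`, `β`, `β_i` and of the projection `π₀`. -/

section Homogeneity

variable {r : ℝ} (hr : r ≠ 0)

theorem smul_gradeConj_bMat : r • gradeConj n r hr (bMat n) = bMat n := by
  ext a c
  rw [Matrix.smul_apply, gradeConj_apply, smul_eq_mul]
  by_cases h : (a : ℕ) = (c : ℕ) + 1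
  · simp only [bMat, Matrix.of_apply, h, if_true, pow_succ]
    field_simp
  · simp [bMat, h]

theorem smul_gradeConj_beta :
    r • gradeConj n r hr (beta n) = r ^ (2 * n) • beta n := by
  ext a c
  rw [Matrix.smul_apply, Matrix.smul_apply, gradeConj_apply, smul_eq_mul, smul_eq_mul]
  by_cases h : ((a : ℕ) = 0 ∧ (c : ℕ) + 1 = 2 * n) ∨ ((a : ℕ) = 1 ∧ (c : ℕ) = 2 * n)
  · have h' : 2 * n + a = c + 1 := by omega
    have h2 : r ^ (2 * n) * r ^ (a : ℕ) = r ^ (c : ℕ) * r := by rw [← pow_add, h', pow_succ]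
    simp only [beta, Matrix.of_apply, if_pos h]
    have h1 : r ^ (a : ℕ) ≠ 0 := pow_ne_zero _ hr
    field_simp
    linear_combination -h2
  · simp only [beta, Matrix.of_apply, if_neg h, mul_zero, zero_mul]

theorem smul_gradeConj_betaV (k : Fin n) :
    r • gradeConj n r hr (betaV n k) = r ^ (2 * ((k : ℕ) + 1)) • betaV n k := by
  ext a c
  rw [Matrix.smul_apply, Matrix.smul_apply, gradeConj_apply, smul_eq_mul, smul_eq_mul]
  by_cases h : ((a : ℕ) + k + 1 = n ∧ (c : ℕ) = n + k) ∨ ((a : ℕ) + k = n ∧ (c : ℕ) = n + k + 1)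
  · have h' : 2 * ((k : ℕ) + 1) + a = c + 1 := by omega
    have h2 : r ^ (2 * ((k : ℕ) + 1)) * r ^ (a : ℕ) = r ^ (c : ℕ) * r := by
      rw [← pow_add, h', pow_succ]
    simp only [betaV, Matrix.of_apply, if_pos h]
    have h1 : r ^ (a : ℕ) ≠ 0 := pow_ne_zero _ hr
    field_simp
    linear_combination -h2
  · simp [betaV, h]

theorem gradeConj_mem_VSub {A : Mat n ℝ} (hA : A ∈ VSub n) : gradeConj n r hr A ∈ VSub n := by
  have h : VSub n ≤ (VSub n).comap (gradeConj n r hr).toLinearMap := by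
    refine Submodule.span_le.2 ?_
    rintro _ ⟨k, rfl⟩
    have h1 : gradeConj n r hr (betaV n k) =
        r⁻¹ • r ^ (2 * ((k : ℕ) + 1)) • betaV n k := by
      rw [← smul_gradeConj_betaV hr, smul_smul, inv_mul_cancel₀ hr, one_smul]
    change gradeConj n r hr (betaV n k) ∈ VSub n
    rw [h1]
    exact (VSub n).smul_mem _ ((VSub n).smul_mem _ (Submodule.subset_span ⟨k, rfl⟩))
  exact h hA

theorem pi0_smul (c : ℝ) (A : Mat n ℝ) : pi0 n (c • A) = c • pi0 n A := by
  simp [pi0, Finset.smul_sum, smul_smul]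

/-- The entry read off by `π₀` lies on the same diagonal as `β_iᵗ`, so both carry the same weight.
-/
theorem pi0_gradeConj (A : Mat n ℝ) :
    pi0 n (gradeConj n r hr A) = gradeConj n r hr (pi0 n A) := by
  rw [pi0, pi0, map_sum]
  refine Finset.sum_congr rfl fun k _ => ?_
  rw [map_smul, gradeConj_apply]
  ext a c
  rw [Matrix.smul_apply, Matrix.smul_apply, gradeConj_apply, smul_eq_mul, smul_eq_mul,
    Matrix.transpose_apply]
  by_cases h : ((c : ℕ) + k + 1 = n ∧ (a : ℕ) = n + k) ∨ ((c : ℕ) + k = n ∧ (a : ℕ) = n + k + 1)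
  · simp only [betaV, Matrix.of_apply, if_pos h]
    -- The subtraction is not truncated, as `k < n`.
    have h' : (n - 1 - k) + (a : ℕ) = c + (n + k) := by omega
    have h2 : r ^ (n - 1 - (k : ℕ)) * r ^ (a : ℕ) = r ^ (c : ℕ) * r ^ (n + (k : ℕ)) := by
      rw [← pow_add, h', pow_add]
    have h1 : r ^ (a : ℕ) ≠ 0 := pow_ne_zero _ hr
    have h3 : r ^ (n + (k : ℕ)) ≠ 0 := pow_ne_zero _ hr
    have h4 : (r ^ (n + (k : ℕ)))⁻¹ * r ^ (n - 1 - (k : ℕ)) = (r ^ (a : ℕ))⁻¹ * r ^ (c : ℕ) := by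
      rw [inv_mul_eq_iff_eq_mul₀ h3, ← mul_assoc, mul_comm (r ^ (n + (k : ℕ))), mul_assoc,
        mul_comm (r ^ (n + (k : ℕ))), ← h2, mul_comm, mul_assoc, mul_inv_cancel₀ h1, mul_one]
    linear_combination A ⟨n + k, by omega⟩ ⟨n - 1 - k, by omega⟩ * h4
  · simp [betaV, h]

end Homogeneity

/-- The substitution `ξ(λ) ↦ c Γ(r)⁻¹ ξ(r^{-2n} λ) Γ(r)` on formal series. -/
def loopConj (n : ℕ) (r : ℝ) (hr : r ≠ 0) (c : ℝ) (ξ : Loop n) : Loop n where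
  coeff i := (c * (r ^ (2 * n)) ^ i) • gradeConj n r hr (ξ.coeff i)
  isPWO_support' := ξ.isPWO_support'.mono fun i hi h => hi (by simp [h])

/-! ### Rescaling the spectral parameter in formal series. -/

section LoopConj

variable {r : ℝ} (hr : r ≠ 0)

theorem coeff_loopConj (c : ℝ) (ξ : Loop n) (i : ℤ) :
    (loopConj n r hr c ξ).coeff i = (c * (r ^ (2 * n)) ^ i) • gradeConj n r hr (ξ.coeff i) := rfl

theorem lamCoeff_loopConj (c : ℝ) (ξ : Loop n) (i : ℤ) :
    lamCoeff (loopConj n r hr c ξ) i =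
      (c * (r ^ (2 * n)) ^ (-i)) • gradeConj n r hr (lamCoeff ξ i) := rfl

theorem support_loopConj_subset (c : ℝ) (ξ : Loop n) :
    (loopConj n r hr c ξ).support ⊆ ξ.support := fun i hi h => hi (by simp [coeff_loopConj, h])

theorem loopConj_add (c : ℝ) (ξ ζ : Loop n) :
    loopConj n r hr c (ξ + ζ) = loopConj n r hr c ξ + loopConj n r hr c ζ := by
  ext1; funext i
  simp [coeff_loopConj, smul_add]

theorem loopConj_mul (c d : ℝ) (ξ ζ : Loop n) :
    loopConj n r hr c ξ * loopConj n r hr d ζ = loopConj n r hr (c * d) (ξ * ζ) := by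
  ext1; funext i
  have h : r ^ (2 * n) ≠ 0 := pow_ne_zero _ hr
  have hterm : ∀ ij : ℤ × ℤ, ij.1 + ij.2 = i →
      (loopConj n r hr c ξ).coeff ij.1 * (loopConj n r hr d ζ).coeff ij.2 =
        (c * d * (r ^ (2 * n)) ^ i) • gradeConj n r hr (ξ.coeff ij.1 * ζ.coeff ij.2) := by
    rintro ⟨k, l⟩ rfl
    rw [coeff_loopConj, coeff_loopConj, smul_mul_smul_comm, map_mul, zpow_add₀ h]
    congr 1
    ring
  rw [coeff_loopConj, HahnSeries.coeff_mul, HahnSeries.coeff_mul, map_sum, Finset.smul_sum]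
  -- If `c` or `d` is zero, the supports shrink; the extra index pairs contribute zero.
  refine (Finset.sum_subset ?_ ?_).trans
    (Finset.sum_congr rfl fun ij hij => hterm ij (Finset.mem_antidiagonal.1 hij).2.2)
  · intro ij hij
    rw [Finset.mem_antidiagonal] at hij ⊢
    exact ⟨support_loopConj_subset hr c ξ hij.1, support_loopConj_subset hr d ζ hij.2.1, hij.2.2⟩
  · intro ij hij hij'
    rw [Finset.mem_antidiagonal] at hij hij'
    by_contra hne
    exact hij' ⟨left_ne_zero_of_mul hne, right_ne_zero_of_mul hne, hij.2.2⟩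

theorem loopConj_pow (c : ℝ) (ξ : Loop n) (m : ℕ) :
    loopConj n r hr c ξ ^ m = loopConj n r hr (c ^ m) (ξ ^ m) := by
  induction m with
  | zero =>
    ext1; funext i
    by_cases h : i = 0
    · subst h; simp [coeff_loopConj]
    · simp [coeff_loopConj, HahnSeries.coeff_one, h]
  | succ m ih => rw [pow_succ, ih, loopConj_mul, pow_succ, pow_succ]

theorem loopConj_mono (c : ℝ) (i : ℤ) (A : Mat n ℝ) :
    loopConj n r hr c (mono i A) = mono i ((c * (r ^ (2 * n)) ^ (-i)) • gradeConj n r hr A) := by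
  ext1; funext k
  by_cases h : k = -i
  · subst h; simp [coeff_loopConj, mono]
  · simp [coeff_loopConj, mono, h]

theorem loopConj_JB : loopConj n r hr r (JB n) = JB n := by
  have h : r ^ (2 * n) ≠ 0 := pow_ne_zero _ hr
  rw [JB, loopConj_add, loopConj_mono, loopConj_mono]
  congr 2
  · rw [mul_comm r, mul_smul, smul_gradeConj_beta hr, smul_smul, zpow_neg_one,
      inv_mul_cancel₀ h, one_smul]
  · simpa using smul_gradeConj_bMat hr

theorem plusEval_loopConj (hr' : (r : ℂ) ≠ 0) (c : ℝ) (ξ : Loop n) (z : ℂ) :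
    plusEval (loopConj n r hr c ξ) z =
      (c : ℂ) • gradeConj n (r : ℂ) hr' (plusEval ξ (((r : ℂ) ^ (2 * n))⁻¹ * z)) := by
  by_cases hc : c = 0
  · simp [plusEval, lamCoeff_loopConj, hc]
  have hc' : (c : ℂ) ≠ 0 := Complex.ofReal_ne_zero.2 hc
  -- Injectivity lets the map pass through the `finsum` without a proof that its support is finite.
  have hinj : Function.Injective
      ((DistribSMul.toAddMonoidHom (Mat n ℂ) (c : ℂ)).comp
        (gradeConj n (r : ℂ) hr').toLinearMap.toAddMonoidHom) :=
    (smul_right_injective (Mat n ℂ) hc').comp (gradeConj_injective hr')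
  refine Eq.trans ?_ (AddMonoidHom.map_finsum_of_injective _ hinj _).symm
  refine finsum_congr fun i => ?_
  change _ = (c : ℂ) • gradeConj n (r : ℂ) hr' ((((r : ℂ) ^ (2 * n))⁻¹ * z) ^ i • _)
  rw [map_smul, ← map_gradeConj hr hr', lamCoeff_loopConj, zpow_neg, zpow_natCast]
  ext a b
  simp only [Matrix.smul_apply, Matrix.map_apply, smul_eq_mul, Complex.ofReal_mul,
    Complex.ofReal_inv, Complex.ofReal_pow, mul_pow, inv_pow]
  ring

end LoopConj
/-- The graded conjugate, multiplied by `c`, of a matrix-valued function of the rescaled variables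
`(αx, γt)`. -/
def rescale {n : ℕ} {K : Type} [Field K] (r : K) (hr : r ≠ 0) (c : K) (α γ : ℝ)
    (A : ℝ × ℝ → Mat n K) (p : ℝ × ℝ) : Mat n K :=
  c • gradeConj n r hr (A (α * p.1, γ * p.2))

theorem rescale_apply {K : Type} [Field K] {r : K} (hr : r ≠ 0) (c : K) (α γ : ℝ)
    (A : ℝ × ℝ → Mat n K) (p : ℝ × ℝ) (a b : Fin (2 * n + 1)) :
    rescale r hr c α γ A p a b =
      c * (r ^ (a : ℕ))⁻¹ * r ^ (b : ℕ) * A (α * p.1, γ * p.2) a b := by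
  rw [rescale, Matrix.smul_apply, gradeConj_apply, smul_eq_mul]
  ring

/-! ### Smoothness and the chain rule under rescaling. -/

section Derivatives

variable {K : Type} [NormedField K] [NormedAlgebra ℝ K] {r : K} (hr : r ≠ 0)

theorem SmoothMat.rescale {A : ℝ × ℝ → Mat n K} (hA : SmoothMat A) (c : K) (α γ : ℝ) :
    SmoothMat (rescale r hr c α γ A) := by
  intro a b
  simp only [rescale_apply]
  refine contDiff_const.mul ((hA a b).comp (f := fun p : ℝ × ℝ => (α * p.1, γ * p.2)) ?_)
  fun_prop

theorem dx_rescale (c : K) (α γ : ℝ) (A : ℝ × ℝ → Mat n K) (p : ℝ × ℝ) :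
    dx (rescale r hr c α γ A) p =
      α • (c • gradeConj n r hr (dx A (α * p.1, γ * p.2))) := by
  ext a b
  simp only [dx, Matrix.of_apply, Matrix.smul_apply, gradeConj_apply, rescale_apply]
  rw [deriv_const_mul_field,
    deriv_comp_mul_left α (fun s => A (s, γ * p.2) a b) p.1]
  simp only [Algebra.smul_def, Algebra.algebraMap_self_apply]
  ring

theorem dt_rescale (c : K) (α γ : ℝ) (A : ℝ × ℝ → Mat n K) (p : ℝ × ℝ) :
    dt (rescale r hr c α γ A) p =
      γ • (c • gradeConj n r hr (dt A (α * p.1, γ * p.2))) := by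
  ext a b
  simp only [dt, Matrix.of_apply, Matrix.smul_apply, gradeConj_apply, rescale_apply]
  rw [deriv_const_mul_field,
    deriv_comp_mul_left γ (fun s => A (α * p.1, s) a b) p.2]
  simp only [Algebra.smul_def, Algebra.algebraMap_self_apply]
  ring

end Derivatives

/-! ### Scaling of `T`, `P_u`, solutions and frames. -/

section Scaling

variable {r : ℝ} (hr : r ≠ 0)

theorem combV_scaleU (j : ℕ) (u : Fin n → ℝ × ℝ → ℝ) :
    combV (scaleU j r u) = rescale r hr r r (r ^ (2 * j - 1)) (combV u) := by
  funext p
  rw [rescale, combV, combV, map_sum, Finset.smul_sum]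
  refine Finset.sum_congr rfl fun k _ => ?_
  rw [map_smul, smul_comm, smul_gradeConj_betaV, smul_smul, scaleU,
    mul_comm (u k _)]

theorem combV_mem_VSub (u : Fin n → ℝ × ℝ → ℝ) (p : ℝ × ℝ) : combV u p ∈ VSub n :=
  Submodule.sum_mem _ fun k _ => Submodule.smul_mem _ _ (Submodule.subset_span ⟨k, rfl⟩)

/-- The chain rule for `∂_x` and the homogeneity of `b + u` give the same factor `r`. -/
theorem adL_rescale (c γ : ℝ) (u Y : ℝ × ℝ → Mat n ℝ) (p : ℝ × ℝ) :
    adL (rescale r hr r r γ u) (rescale r hr c r γ Y) p =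
      (r * c) • gradeConj n r hr (adL u Y (r * p.1, γ * p.2)) := by
  have hb : bMat n + rescale r hr r r γ u p =
      r • gradeConj n r hr (bMat n + u (r * p.1, γ * p.2)) := by
    rw [map_add, smul_add, smul_gradeConj_bMat, rescale]
  rw [adL, dx_rescale, hb, rescale, adL, smul_mul_smul_comm, smul_mul_smul_comm, ← map_mul,
    ← map_mul, smul_smul, mul_comm c r, ← smul_sub, ← map_sub, ← smul_add, ← map_add]

/-- No equation for `T` differentiates in `t`, so the time scale `γ` is free here. -/
theorem IsT.rescale {u : ℝ × ℝ → Mat n ℝ} {T : ℝ × ℝ → Loop n} (hT : IsT n u T)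
    (γ : ℝ) :
    IsT n (rescale r hr r r γ u) fun p => loopConj n r hr r (T (r * p.1, γ * p.2)) := by
  have hs : r ^ (2 * n) ≠ 0 := pow_ne_zero _ hr
  have hcoeff : ∀ i : ℤ, (fun p : ℝ × ℝ => lamCoeff (loopConj n r hr r (T (r * p.1, γ * p.2))) i) =
      BnKdV.rescale r hr (r * (r ^ (2 * n)) ^ (-i)) r γ fun p => lamCoeff (T p) i := fun i => rfl
  refine ⟨fun i => ?_, fun p i => ?_, fun p => ?_, fun p i hi => ?_, fun p i => ?_, fun p => ?_⟩
  · rw [hcoeff]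
    exact (hT.smooth i).rescale hr _ _ _
  · exact ((hT.mem_o _ i).gradeConj hr).smul _
  · rw [lamCoeff_loopConj, hT.coeff_one, mul_comm r, mul_smul, smul_gradeConj_beta hr, smul_smul,
      zpow_neg_one, inv_mul_cancel₀ hs, one_smul]
  · rw [lamCoeff_loopConj, hT.coeff_gt _ i hi, map_zero, smul_zero]
  · have hJ : JB n + mono 0 (BnKdV.rescale r hr r r γ u p) =
        loopConj n r hr r (JB n + mono 0 (u (r * p.1, γ * p.2))) := by
      rw [loopConj_add, loopConj_JB hr, loopConj_mono, neg_zero, zpow_zero, mul_one,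
        BnKdV.rescale]
    have hsub : ∀ ξ ζ : Loop n, lamCoeff (ξ - ζ) i = lamCoeff ξ i - lamCoeff ζ i :=
      fun ξ ζ => HahnSeries.coeff_sub ..
    have h := congrArg (fun M => (r * (r * (r ^ (2 * n)) ^ (-i))) • gradeConj n r hr M)
      (hT.commute (r * p.1, γ * p.2) i)
    rw [hcoeff, dx_rescale, hJ, loopConj_mul, loopConj_mul, hsub, lamCoeff_loopConj,
      lamCoeff_loopConj]
    simp only [hsub, map_add, map_sub, map_zero, smul_zero, smul_add, smul_sub, mul_assoc,
      smul_smul] at h ⊢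
    exact h
  -- The substitution sends `λ` to `r^{-2n}λ`; the factor `r^{2n}` compensates and supplies the rest
  -- of `r^{2n+1}`.
  · have h1 : (mono 1 1 : Loop n) = loopConj n r hr (r ^ (2 * n)) (mono 1 1) := by
      rw [loopConj_mono, map_one, zpow_neg_one, mul_inv_cancel₀ hs, one_smul]
    rw [loopConj_pow, hT.pow, h1, loopConj_mul, pow_succ, ← h1]

/-- The conditions are linear in `(v, Y)`, so the factor `c` is arbitrary. -/
theorem IsP.rescale {u v Y : ℝ × ℝ → Mat n ℝ} (hY : IsP n u v Y) (c γ : ℝ) :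
    IsP n (rescale r hr r r γ u) (rescale r hr c r γ v) (rescale r hr c r γ Y) := by
  refine ⟨hY.smooth.rescale hr _ _ _, fun p => ((hY.mem_o _).gradeConj hr).smul _, fun p => ?_,
    fun p => ?_⟩
  · rw [adL_rescale]
    exact (VSub n).smul_mem _ (gradeConj_mem_VSub hr (hY.mem_V _))
  · rw [BnKdV.rescale, pi0_smul, pi0_gradeConj, hY.proj, BnKdV.rescale]

theorem lamCoeff_zero_loopConj_pow (ξ : Loop n) (m : ℕ) :
    lamCoeff (loopConj n r hr r ξ ^ m) 0 = r ^ m • gradeConj n r hr (lamCoeff (ξ ^ m) 0) := by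
  rw [loopConj_pow, lamCoeff_loopConj, neg_zero, zpow_zero, mul_one]

/-- The rescaling maps the potential `P_u(π₀(T_{2j-1,0}(u)))` of `u` to that of `r ⊙ u`. -/
theorem IsP.rescale_flow {u Y : ℝ × ℝ → Mat n ℝ} {T : ℝ × ℝ → Loop n} {m : ℕ}
    (hY : IsP n u (fun p => pi0 n (lamCoeff (T p ^ m) 0)) Y) :
    IsP n (BnKdV.rescale r hr r r (r ^ m) u)
      (fun p => pi0 n (lamCoeff (loopConj n r hr r (T (r * p.1, r ^ m * p.2)) ^ m) 0))
      (BnKdV.rescale r hr (r ^ m) r (r ^ m) Y) := by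
  have h := hY.rescale hr (r ^ m) (r ^ m)
  have hv : (fun p : ℝ × ℝ =>
      pi0 n (lamCoeff (loopConj n r hr r (T (r * p.1, r ^ m * p.2)) ^ m) 0)) =
      BnKdV.rescale r hr (r ^ m) r (r ^ m) fun p => pi0 n (lamCoeff (T p ^ m) 0) := by
    funext p
    rw [lamCoeff_zero_loopConj_pow, pi0_smul, pi0_gradeConj, BnKdV.rescale]
  rw [hv]
  exact h

/-- Both sides of the flow scale by `r · r^{2j-1}`: on the left from `u` and `∂_t`, on the right
from `[∂_x + b + u, ·]` and `P_u`. -/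
theorem IsKdVSolution.scale {j : ℕ} {u : Fin n → ℝ × ℝ → ℝ}
    (hu : IsKdVSolution n j (combV u)) (hr : r ≠ 0) :
    IsKdVSolution n j (combV (scaleU j r u)) := by
  obtain ⟨hs, -, T, Y, hT, hY, hflow⟩ := hu
  refine ⟨?_, combV_mem_VSub _, fun p => loopConj n r hr r (T (r * p.1, r ^ (2 * j - 1) * p.2)),
    rescale r hr (r ^ (2 * j - 1)) r (r ^ (2 * j - 1)) Y, ?_⟩
  all_goals rw [combV_scaleU hr]
  · exact hs.rescale hr _ _ _
  · refine ⟨hT.rescale hr _, hY.rescale_flow hr, fun p => ?_⟩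
    rw [dt_rescale, hflow, adL_rescale, smul_smul, mul_comm r (r ^ (2 * j - 1))]

theorem scaleE_eq_rescale (hr : (r : ℂ) ≠ 0) (j : ℕ) (E : ℝ × ℝ → ℂ → Mat n ℂ) (z : ℂ) :
    (fun p => scaleE j r E p z) = rescale (r : ℂ) hr 1 r (r ^ (2 * j - 1))
      fun p => E p (((r : ℂ) ^ (2 * n))⁻¹ * z) := by
  funext p
  rw [scaleE, gam_inv_mul_mul_gam hr, rescale, one_smul]

theorem IsOC.isUnit_det {g : Mat n ℂ} (hg : IsOC n g) : IsUnit g.det := by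
  rw [hg.1]; exact isUnit_one

theorem gradeConj_inv {r : ℂ} (hr : r ≠ 0) {g : Mat n ℂ} (hg : IsUnit g.det) :
    (gradeConj n r hr g)⁻¹ = gradeConj n r hr g⁻¹ := by
  refine Matrix.inv_eq_left_inv ?_
  rw [← map_mul, Matrix.nonsing_inv_mul _ hg, map_one]

theorem IsKdVFrame.scale {j : ℕ} {u : Fin n → ℝ × ℝ → ℝ}
    {E : ℝ × ℝ → ℂ → Mat n ℂ} (hE : IsKdVFrame n j (combV u) E) (hr : r ≠ 0) :
    IsKdVFrame n j (combV (scaleU j r u)) (scaleE j r E) := by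
  have hr' : (r : ℂ) ≠ 0 := Complex.ofReal_ne_zero.2 hr
  obtain ⟨hO, hs, hd, hc, hx, T, Y, hT, hY, ht⟩ := hE
  have hval : ∀ p z, scaleE j r E p z = gradeConj n (r : ℂ) hr'
      (E (r * p.1, r ^ (2 * j - 1) * p.2) (((r : ℂ) ^ (2 * n))⁻¹ * z)) :=
    fun p z => gam_inv_mul_mul_gam hr' _
  refine ⟨fun p z => ?_, fun z => ?_, fun p a c => ?_, fun p z => ?_, fun p z => ?_,
    fun p => loopConj n r hr r (T (r * p.1, r ^ (2 * j - 1) * p.2)),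
    rescale r hr (r ^ (2 * j - 1)) r (r ^ (2 * j - 1)) Y, ?_⟩
  · rw [hval]
    exact (hO _ _).gradeConj hr'
  · rw [scaleE_eq_rescale hr']
    exact (hs _).rescale hr' _ _ _
  · simp only [hval, gradeConj_apply]
    exact (((hd _ a c).comp (differentiable_id.const_mul _)).const_mul _).mul_const _
  · rw [hval, hval]
    have hz : ((r : ℂ) ^ (2 * n))⁻¹ * (starRingEnd ℂ) z =
        (starRingEnd ℂ) (((r : ℂ) ^ (2 * n))⁻¹ * z) := by
      simp
    rw [hz]
    ext a c
    have h := congrFun (congrFun (hc (r * p.1, r ^ (2 * j - 1) * p.2)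
      (((r : ℂ) ^ (2 * n))⁻¹ * z)) a) c
    rw [Matrix.map_apply] at h
    simp only [Matrix.map_apply, gradeConj_apply, map_mul, map_inv₀, map_pow,
      Complex.conj_ofReal] at h ⊢
    rw [h]
  · rw [scaleE_eq_rescale hr', dx_rescale, hval, gradeConj_inv hr' (hO _ _).isUnit_det, one_smul,
      Matrix.mul_smul, ← map_mul, hx, combV_scaleU hr]
    -- The spectral scale `r^{-2n}` in `r ⊙ E` exactly cancels the weight of `β`.
    have hbeta : ((r : ℂ) ^ (2 * n))⁻¹ • ((r • gradeConj n r hr (beta n)).map Complex.ofReal) =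
        (beta n).map Complex.ofReal := by
      rw [smul_gradeConj_beta hr]
      ext a c
      simp [hr]
    have hb : (bMat n + rescale r hr r r (r ^ (2 * j - 1)) (combV u) p) =
        r • gradeConj n r hr (bMat n + combV u (r * p.1, r ^ (2 * j - 1) * p.2)) := by
      rw [map_add, smul_add, smul_gradeConj_bMat, rescale]
    rw [hb, map_add, map_smul, ← map_gradeConj hr hr', ← map_gradeConj hr hr', ← hbeta]
    ext a c
    simp only [Matrix.smul_apply, Matrix.add_apply, Matrix.map_apply, smul_eq_mul,
      Complex.real_smul, Complex.ofReal_mul]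
    ring
  · rw [combV_scaleU hr]
    refine ⟨hT.rescale hr _, hY.rescale_flow hr, fun p z => ?_⟩
    rw [scaleE_eq_rescale hr', dt_rescale, hval, gradeConj_inv hr' (hO _ _).isUnit_det, one_smul,
      Matrix.mul_smul, ← map_mul, ht, lamCoeff_zero_loopConj_pow, loopConj_pow,
      plusEval_loopConj hr hr', rescale, ← smul_sub, ← map_sub, map_sub, ← map_gradeConj hr hr']
    ext a c
    simp only [Matrix.smul_apply, Matrix.sub_apply, Matrix.map_apply, smul_eq_mul,
      Complex.real_smul, Complex.ofReal_mul]
    ring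

theorem scaleU_one (j : ℕ) (u : Fin n → ℝ × ℝ → ℝ) : scaleU j 1 u = u := by
  funext k p
  simp [scaleU]

theorem scaleU_mul (j : ℕ) (r s : ℝ) (u : Fin n → ℝ × ℝ → ℝ) :
    scaleU j (r * s) u = scaleU j r (scaleU j s u) := by
  funext k p
  simp only [scaleU, mul_pow, mul_assoc, mul_left_comm s, mul_left_comm (s ^ (2 * j - 1))]

/-- The action of the multiplicative group of positive reals on solutions by rescaling. -/
@[reducible]
def scalingAction (n j : ℕ) : MulAction {r : ℝ // 0 < r} (SolSpace n j) where
  smul r u := ⟨scaleU j r.1 u.1, u.2.scale r.2.ne'⟩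
  one_smul u := Subtype.ext (scaleU_one j u.1)
  mul_smul r s u := Subtype.ext (scaleU_mul j r.1 s.1 u.1)

end Scaling

end BnKdV

end

theorem mainTheorem8 (n j : ℕ) (hn : 1 ≤ n) (hj : 1 ≤ j) :
    (∀ (r : ℝ), r ≠ 0 → ∀ (u : Fin n → ℝ × ℝ → ℝ),
      BnKdV.IsKdVSolution n j (BnKdV.combV u) →
        BnKdV.IsKdVSolution n j (BnKdV.combV (BnKdV.scaleU j r u)) ∧
        ∀ (E : ℝ × ℝ → ℂ → BnKdV.Mat n ℂ),
          BnKdV.IsKdVFrame n j (BnKdV.combV u) E →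
          BnKdV.IsKdVFrame n j (BnKdV.combV (BnKdV.scaleU j r u)) (BnKdV.scaleE j r E)) ∧
    ∃ act : MulAction {r : ℝ // 0 < r} (BnKdV.SolSpace n j),
      ∀ (r : {r : ℝ // 0 < r}) (u : BnKdV.SolSpace n j),
        (act.toSMul.smul r u).1 = BnKdV.scaleU j r.1 u.1 :=
  ⟨fun _ hr _ hu => ⟨hu.scale hr, fun _ hE => hE.scale hr⟩,
    BnKdV.scalingAction n j, fun _ _ => rfl⟩
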